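/- Let the locations $x_1,x_2,\dots$ of caching helpers form a homogeneous Poisson point process of intensity $\lambda>0$ in $\mathbb{R}^2$, with the typical user at the origin, and let $\alpha>2$ be the path loss exponent. Each helper caches content $i$ of a finite library with probability $p_i\in[0,1]$, independently of the other helpers. Let $h_n$ be the fading coefficient of the channel from helper $n$ to the typical user; the $h_n$ are independent of each other, of the helper locations and of the caches (and the caches are independent of the locations), and follow Nakagami-$m_D$ fading with $m_D\ge\frac12$, i.e. the power gain $|h_n|^2$ has density $\frac{m_D^{m_D}}{\Gamma(m_D)}y^{m_D-1}e^{-m_Dy}$ on $y\ge 0$. For a content $i$ let $$\xi_{i,1}=\min\left\{\frac{|x_n|^\alpha}{|h_n|^2} : \text{helper } n \text{ caches content } i\right\}$$ be the smallest reciprocal channel power gain among the helpers caching content $i$ (with $\xi_{i,1}=\infty$ if there is no such helper). If $p_i>0$, then this minimum exists almost surely; and for every $p_i\in[0,1]$ the CDF of $\xi_{i,1}$ is $$F_{\xi_{i,1}}(\xi)=\mathbb{P}(\xi_{i,1}\le\xi)=\mathbb{P}(\xi_{i,1}<\xi)=1-\exp\left(-\kappa p_i\xi^{\delta}\right),\qquad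 \xi\ge 0,$$ where $\delta=\frac{2}{\alpha}$ and $\kappa=\pi\lambda\frac{\Gamma(\delta+m_D)}{m_D^{\delta}\Gamma(m_D)}$. -/

import Mathlib

open MeasureTheory ProbabilityTheory
open scoped ENNReal

noncomputable section

namespace WirelessCaching

/-- The plane in which the helpers are located; the typical user sits at the origin. -/
abbrev Plane : Type := EuclideanSpace ℝ (Fin 2)

variable {Ω : Type*} [MeasurableSpace Ω]

/-- The number of points of the enumerated point configuration `x 0 ω, x 1 ω, …` in `B`. -/
def pointCount {E : Type*} (x : ℕ → Ω → E) (B : Set E) (ω : Ω) : ℕ∞ :=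
  {n : ℕ | x n ω ∈ B}.encard

/-- The random points `x 0, x 1, …` form a Poisson point process with intensity measure `Λ`:
the number of points in a measurable set of finite intensity is Poisson distributed with mean
`Λ B`, and the numbers of points in finitely many pairwise disjoint such sets are independent.
(An enumeration by all of `ℕ` is the general case as soon as `Λ` has infinite total mass.) -/
structure IsPoissonPointProcess {E : Type*} [MeasurableSpace E]
    (x : ℕ → Ω → E) (Λ : Measure E) (P : Measure Ω) : Prop where
  measurable : ∀ n, Measurable (x n)
  count_hasLaw : ∀ B : Set E, MeasurableSet B → Λ B < ∞ →
    HasLaw (pointCount x B) ((poissonMeasure (Λ B).toNNReal).map (fun k : ℕ => (k : ℕ∞))) P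
  count_indep : ∀ (k : ℕ) (B : Fin k → Set E), (∀ j, MeasurableSet (B j)) →
    (∀ j, Λ (B j) < ∞) → Pairwise (Function.onFun Disjoint B) →
    iIndepFun (fun j => pointCount x (B j)) P

/-- `h` is the coefficient of a Nakagami fading channel with parameter `m` (and unit mean power):
the power gain `|h|²` has density `m ^ m / Γ(m) * y ^ (m - 1) * exp (- m * y)` on `y ≥ 0`,
the gamma density with shape `m` and rate `m`. -/
def IsNakagamiFading (m : ℝ) (h : Ω → ℂ) (P : Measure Ω) : Prop :=
  HasLaw (fun ω => ‖h ω‖ ^ 2) (gammaMeasure m m) P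

/-- The network seen from the typical user: helper `n` is located at `x n`, its channel to the
typical user has fading coefficient `h n`, and it caches the random set `C n` of contents out of
a library of `F` contents. The helpers form a homogeneous Poisson point process of intensity
`lam`; each fading coefficient is Nakagami with parameter `m`; each helper caches content `i` with
probability `p i`. The marks `(h n, C n)` of different helpers are independent, the family of
all marks is independent of the locations, and fading is independent of caching. The joint law
of the events `i ∈ C n` for fixed `n` and different `i` is arbitrary. -/
structure IsCachingNetwork {F : ℕ} (lam m : ℝ) (p : Fin F → ℝ)
    (x : ℕ → Ω → Plane) (h : ℕ → Ω → ℂ) (C : ℕ → Ω → Set (Fin F)) (P : Measure Ω) : Prop where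
  helpers_poisson : IsPoissonPointProcess x (ENNReal.ofReal lam • (volume : Measure Plane)) P
  measurable_fading : ∀ n, Measurable (h n)
  measurable_cache : ∀ n, Measurable (C n)
  fading : ∀ n, IsNakagamiFading m (h n) P
  cache_prob : ∀ n i, P.real {ω | i ∈ C n ω} = p i
  indep_fading_cache : ∀ n, IndepFun (h n) (C n) P
  indep_marks : iIndepFun (fun n ω => (h n ω, C n ω)) P
  indep_locations_marks : IndepFun (fun ω n => x n ω) (fun ω n => (h n ω, C n ω)) P

/-- The reciprocal `|x| ^ α / |h|²` of the channel power gain to the origin from a helper at `x`,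
with path loss exponent `α` and fading coefficient `h`. It is `∞` if `h = 0` and `x ≠ 0`. -/
def reciprocalGain (α : ℝ) (x : Plane) (h : ℂ) : ℝ≥0∞ :=
  ENNReal.ofReal (‖x‖ ^ α) / ENNReal.ofReal (‖h‖ ^ 2)

/-- The set of the reciprocal channel power gains of the helpers that cache content `i`. -/
def reciprocalGains {F : ℕ} (α : ℝ) (x : ℕ → Ω → Plane) (h : ℕ → Ω → ℂ)
    (C : ℕ → Ω → Set (Fin F)) (i : Fin F) (ω : Ω) : Set ℝ≥0∞ :=
  {y | ∃ n, i ∈ C n ω ∧ y = reciprocalGain α (x n ω) (h n ω)}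

/-- The smallest reciprocal channel power gain among the helpers that cache content `i`
(`∞` if there is no such helper). -/
def minReciprocalGain {F : ℕ} (α : ℝ) (x : ℕ → Ω → Plane) (h : ℕ → Ω → ℂ)
    (C : ℕ → Ω → Set (Fin F)) (i : Fin F) (ω : Ω) : ℝ≥0∞ :=
  sInf (reciprocalGains α x h C i ω)

end WirelessCaching

end

/-!
# The smallest reciprocal channel gain in a Poisson caching network

The event that no helper caching content `i` has a reciprocal gain below `ξ` has probability
`exp (-μ)`, where `μ` is the mean number of such helpers: this is the void probability of an
independently marked Poisson process. It is obtained by conditioning on the locations, given which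
a helper at `y` avoids the event with probability `1 - g y`, independently of the others
(`measure_forall_marked_notMem`), and by evaluating the generating functional
`E ∏ (1 - g (x n)) = exp (-∫ g)` (`lintegral_iInf_prod_one_sub`). The latter follows from the
defining Poisson counts for a simple function `g`, where the product is a product of powers of
independent Poisson variables, and then by monotone approximation.

The mean `∫ g` is computed by exchanging the integrals over the location and over the power gain
`t`: for a fixed `t` the admissible locations form a disc of area `π (ξ t) ^ (2 / α)`, and the
gamma law of `t` has an explicit moment of order `2 / α` (`lintegral_goodProb`).

The formula is continuous in `ξ`, so it also gives the probability of `≤ ξ`. The infimum is attained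
because Campbell's formula makes the number of helpers with gain below `ξ` almost surely finite
(`ae_finite_goodHelpers`), while the distribution function tends to `1` when `p i > 0`.
-/

namespace WirelessCaching

/-! ### The probability generating function of a Poisson variable -/

theorem lintegral_pow_toNat_poissonMeasure (r : NNReal) {a : ℝ≥0∞} (ha : a ≤ 1) :
    ∫⁻ k, a ^ k.toNat ∂((poissonMeasure r).map (fun k : ℕ => (k : ℕ∞)))
      = ENNReal.ofReal (Real.exp (-(r * (1 - a).toReal))) := by
  have hat : a ≠ ∞ := ne_top_of_le_ne_top ENNReal.one_ne_top ha
  rw [lintegral_map (measurable_of_countable _) (measurable_of_countable _), poissonMeasure,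
    lintegral_sum_measure, ENNReal.toReal_sub_of_le ha ENNReal.one_ne_top, ENNReal.toReal_one]
  simp only [lintegral_smul_measure, lintegral_dirac, ENat.toNat_natCast, smul_eq_mul]
  lift a to NNReal using hat with t
  have hsum : HasSum (fun n : ℕ => Real.exp (-r) * r ^ n / n.factorial * (t : ℝ) ^ n)
      (Real.exp (-(r * (1 - t)))) := by
    have h := (NormedSpace.expSeries_div_hasSum_exp (r * t : ℝ)).mul_left (Real.exp (-r))
    rw [← Real.exp_eq_exp_ℝ, ← Real.exp_add] at h
    rw [show -(r * (1 - t) : ℝ) = -r + r * t by ring]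
    refine h.congr_fun fun n => ?_
    rw [mul_pow]
    ring
  rw [ENNReal.coe_toReal, ← hsum.tsum_eq,
    ENNReal.ofReal_tsum_of_nonneg (fun n => by positivity) hsum.summable]
  refine tsum_congr fun n => ?_
  rw [ENNReal.ofReal_mul (by positivity), ENNReal.ofReal_pow (by positivity),
    ENNReal.ofReal_coe_nnreal]

theorem lintegral_toENNReal_poissonMeasure (r : NNReal) :
    ∫⁻ k : ℕ∞, (k : ℝ≥0∞) ∂((poissonMeasure r).map (fun k : ℕ => (k : ℕ∞))) = r := by
  rw [lintegral_map (measurable_of_countable _) (measurable_of_countable _), poissonMeasure,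
    lintegral_sum_measure]
  simp only [lintegral_smul_measure, lintegral_dirac, smul_eq_mul, ENat.toENNReal_coe]
  have hsum : HasSum (fun n : ℕ => Real.exp (-r) * r ^ n / n.factorial * (n : ℝ)) r := by
    have h := (NormedSpace.expSeries_div_hasSum_exp (r : ℝ)).mul_left (Real.exp (-r) * r)
    rw [← Real.exp_eq_exp_ℝ, mul_right_comm, ← Real.exp_add, neg_add_cancel, Real.exp_zero,
      one_mul] at h
    rw [← hasSum_nat_add_iff' 1]
    simp only [Finset.range_one, Finset.sum_singleton, Nat.cast_zero, mul_zero, sub_zero]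
    refine h.congr_fun fun n => ?_
    rw [Nat.factorial_succ]
    push_cast
    field_simp
    ring
  calc ∑' n : ℕ, ENNReal.ofReal (Real.exp (-r) * r ^ n / n.factorial) * (n : ℝ≥0∞)
      = ∑' n : ℕ, ENNReal.ofReal (Real.exp (-r) * r ^ n / n.factorial * (n : ℝ)) :=
        tsum_congr fun n => by
          rw [ENNReal.ofReal_mul (by positivity), ENNReal.ofReal_natCast]
    _ = r := by
        rw [← ENNReal.ofReal_tsum_of_nonneg (fun n => by positivity) hsum.summable,
          hsum.tsum_eq, ENNReal.ofReal_coe_nnreal]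

/-! ### Poisson point processes: counts, mean measure and generating functional -/

theorem toENNReal_pointCount {Ω E : Type*} (x : ℕ → Ω → E) (B : Set E) (ω : Ω) :
    (pointCount x B ω : ℝ≥0∞) = ∑' n, B.indicator 1 (x n ω) := by
  rw [pointCount, ← ENNReal.tsum_set_one, tsum_subtype {n | x n ω ∈ B} (fun _ => (1 : ℝ≥0∞))]
  rfl

section PoissonProcess

variable {Ω : Type*} [MeasurableSpace Ω] {E : Type*} [MeasurableSpace E]
  {x : ℕ → Ω → E} {Λ : Measure E} {P : Measure Ω}

theorem measurable_pointCount (hx : ∀ n, Measurable (x n)) {B : Set E} (hB : MeasurableSet B) :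
    Measurable (pointCount x B) := by
  have h : Measurable fun ω => (pointCount x B ω : ℝ≥0∞) := by
    simp only [toENNReal_pointCount]
    exact Measurable.tsum fun n => (measurable_one.indicator hB).comp (hx n)
  refine measurable_to_countable' fun k => ?_
  convert h (measurableSet_singleton (k : ℝ≥0∞)) using 1
  ext ω
  simp

theorem ae_pointCount_ne_top (hx : IsPoissonPointProcess x Λ P) {B : Set E}
    (hB : MeasurableSet B) (hfin : Λ B < ∞) : ∀ᵐ ω ∂P, pointCount x B ω ≠ ⊤ := by
  refine ((hx.count_hasLaw B hB hfin).ae_iff (p := fun k => k ≠ ⊤)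
    (measurable_of_countable _)).2 ?_
  rw [ae_map_iff (measurable_of_countable _).aemeasurable (MeasurableSet.of_discrete)]
  exact ae_of_all _ fun k => ENat.natCast_ne_top k

/-- The joint probability generating function of the counts of a Poisson process in disjoint
sets. -/
theorem lintegral_prod_pow_pointCount [IsProbabilityMeasure P] (hx : IsPoissonPointProcess x Λ P)
    {ι : Type*} (T : Finset ι) (B : ι → Set E) (a : ι → ℝ≥0∞) (ha : ∀ c, a c ≤ 1)
    (hB : ∀ c, MeasurableSet (B c)) (hfin : ∀ c ∈ T, Λ (B c) < ∞)
    (hd : Pairwise (Function.onFun Disjoint B)) :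
    ∫⁻ ω, ∏ c ∈ T, a c ^ (pointCount x (B c) ω).toNat ∂P
      = ∏ c ∈ T, ENNReal.ofReal (Real.exp (-((Λ (B c)).toReal * (1 - a c).toReal))) := by
  have reindex (f : ι → ℝ≥0∞) : ∏ c ∈ T, f c = ∏ j, f (T.equivFin.symm j) := by
    rw [← Finset.prod_coe_sort, ← Equiv.prod_comp T.equivFin.symm]
  simp only [reindex]
  have hind := hx.count_indep T.card (fun j => B (T.equivFin.symm j)) (fun j => hB _)
    (fun j => hfin _ (T.equivFin.symm j).2)
    (fun j k hjk => hd fun h => hjk (T.equivFin.symm.injective (Subtype.ext h)))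
  have hmeas (j : Fin T.card) : Measurable (fun k : ℕ∞ => a (T.equivFin.symm j) ^ k.toNat) :=
    measurable_of_countable _
  have := lintegral_prod_eq_prod_lintegral_of_indepFun Finset.univ _ (hind.comp _ hmeas)
    (fun j => (hmeas j).comp (measurable_pointCount hx.measurable (hB _)))
  simp only [Function.comp_def] at this
  rw [this]
  refine Finset.prod_congr rfl fun j _ => ?_
  rw [(hx.count_hasLaw _ (hB _) (hfin _ (T.equivFin.symm j).2)).lintegral_comp
    (f := fun k => a (T.equivFin.symm j) ^ k.toNat) (hmeas j).aemeasurable,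
    lintegral_pow_toNat_poissonMeasure _ (ha _)]
  rfl

theorem antitone_prod_one_sub (f : ℕ → ℝ≥0∞) :
    Antitone fun N => ∏ n ∈ Finset.range N, (1 - f n) :=
  antitone_nat_of_succ_le fun N => by
    rw [Finset.prod_range_succ]
    exact mul_le_of_le_one_right' tsub_le_self

/-- If `f` takes nonzero values in the finite set `T` and each value of `T` finitely often, then
the infinite product `∏ (1 - f n)` is finite and can be grouped by the values of `f`. -/
theorem iInf_prod_one_sub_eq_prod_pow (f : ℕ → ℝ≥0∞) (T : Finset ℝ≥0∞)
    (hT : ∀ n, f n ≠ 0 → f n ∈ T) (hfin : ∀ c ∈ T, {n | f n = c}.Finite) :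
    ⨅ N, ∏ n ∈ Finset.range N, (1 - f n) = ∏ c ∈ T, (1 - c) ^ {n | f n = c}.ncard := by
  classical
  have hS : {n | f n ∈ T}.Finite := by
    refine (T.finite_toSet.biUnion hfin).subset fun n hn => ?_
    simpa using hn
  have hval : ∏ n ∈ hS.toFinset, (1 - f n) = ∏ c ∈ T, (1 - c) ^ {n | f n = c}.ncard := by
    rw [← Finset.prod_fiberwise_of_maps_to (t := T) (g := f) (by simp)]
    refine Finset.prod_congr rfl fun c hc => ?_
    rw [Finset.prod_congr rfl (g := fun _ => 1 - c) (by simp +contextual), Finset.prod_const,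
      ← Set.ncard_coe_finset]
    congr 2
    ext n
    simp only [Finset.coe_filter, Set.Finite.mem_toFinset, Set.mem_ofPred_eq]
    exact ⟨fun h => h.2, fun h => ⟨h ▸ hc, h⟩⟩
  obtain ⟨M, hM⟩ := hS.toFinset.exists_nat_subset_range
  refine tendsto_nhds_unique (tendsto_atTop_iInf (antitone_prod_one_sub f)) ?_
  refine tendsto_const_nhds.congr' ?_
  filter_upwards [Filter.eventually_ge_atTop M] with N hN
  rw [← hval]
  refine Finset.prod_subset (hM.trans (Finset.range_mono hN)) fun n _ hn => ?_
  have : f n = 0 := by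
    by_contra h
    exact hn (by simpa using hT n h)
  simp [this]

/-- The generating functional at a simple function is the joint generating function of the counts
in its level sets. -/
theorem lintegral_iInf_prod_one_sub_simpleFunc [IsProbabilityMeasure P]
    (hx : IsPoissonPointProcess x Λ P) (s : SimpleFunc E ℝ≥0∞) (hs : ∀ y, s y ≤ 1)
    (hfin : ∫⁻ y, s y ∂Λ ≠ ∞) :
    ∫⁻ ω, ⨅ N, ∏ n ∈ Finset.range N, (1 - s (x n ω)) ∂P
      = ENNReal.ofReal (Real.exp (-(∫⁻ y, s y ∂Λ).toReal)) := by
  classical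
  -- The zero level is dropped: it may have infinite measure, and contributes factors `1` only.
  set T := s.range.filter (· ≠ 0)
  have hlevel : ∀ c ∈ T, Λ (s ⁻¹' {c}) < ∞ := fun c hc =>
    SimpleFunc.finMeasSupp_iff.1 (SimpleFunc.FinMeasSupp.of_lintegral_ne_top
      (by rwa [← SimpleFunc.lintegral_eq_lintegral])) c (Finset.mem_filter.1 hc).2
  have hT1 : ∀ c ∈ T, c ≤ 1 := fun c hc => by
    obtain ⟨y, rfl⟩ := SimpleFunc.mem_range.1 (Finset.mem_filter.1 hc).1
    exact hs y
  have hae : ∀ᵐ ω ∂P, ⨅ N, ∏ n ∈ Finset.range N, (1 - s (x n ω))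
      = ∏ c ∈ T, (1 - c) ^ (pointCount x (s ⁻¹' {c}) ω).toNat := by
    have : ∀ᵐ ω ∂P, ∀ c ∈ T, pointCount x (s ⁻¹' {c}) ω ≠ ⊤ :=
      (Finset.eventually_all T).2 fun c hc =>
        ae_pointCount_ne_top hx (s.measurableSet_fiber c) (hlevel c hc)
    filter_upwards [this] with ω hω
    refine iInf_prod_one_sub_eq_prod_pow (fun n => s (x n ω)) T (fun n hn => ?_) fun c hc => ?_
    · exact Finset.mem_filter.2 ⟨SimpleFunc.mem_range_self _ _, hn⟩
    · exact Set.encard_ne_top_iff.1 (hω c hc)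
  rw [lintegral_congr_ae hae, lintegral_prod_pow_pointCount hx T (fun c => s ⁻¹' {c})
    (fun c => 1 - c) (fun _ => tsub_le_self) (fun c => s.measurableSet_fiber c) hlevel
    (fun c d hcd => Disjoint.preimage _ (by simpa using hcd)),
    ← ENNReal.ofReal_prod_of_nonneg (fun _ _ => (Real.exp_pos _).le), ← Real.exp_sum,
    Finset.sum_neg_distrib]
  congr 3
  have hint : ∫⁻ y, s y ∂Λ = ∑ c ∈ T, c * Λ (s ⁻¹' {c}) := by
    rw [SimpleFunc.lintegral_eq_lintegral s Λ, SimpleFunc.lintegral,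
      Finset.sum_filter_of_ne fun c _ h => left_ne_zero_of_mul h]
  rw [hint, ENNReal.toReal_sum fun c hc => ENNReal.mul_ne_top
      (ne_top_of_le_ne_top ENNReal.one_ne_top (hT1 c hc)) (hlevel c hc).ne]
  refine Finset.sum_congr rfl fun c hc => ?_
  rw [ENNReal.toReal_mul, ENNReal.sub_sub_cancel ENNReal.one_ne_top (hT1 c hc), mul_comm]

/-- The probability generating functional of a Poisson process, `E ∏ (1 - g (x n)) = exp (-∫ g)`.
The infinite product is written as the infimum of its decreasing partial products. -/
theorem lintegral_iInf_prod_one_sub [IsProbabilityMeasure P]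
    (hx : IsPoissonPointProcess x Λ P) {g : E → ℝ≥0∞} (hg : Measurable g) (hg1 : ∀ y, g y ≤ 1)
    (hfin : ∫⁻ y, g y ∂Λ ≠ ∞) :
    ∫⁻ ω, ⨅ N, ∏ n ∈ Finset.range N, (1 - g (x n ω)) ∂P
      = ENNReal.ofReal (Real.exp (-(∫⁻ y, g y ∂Λ).toReal)) := by
  set s : ℕ → SimpleFunc E ℝ≥0∞ := SimpleFunc.eapprox g
  have hle (k : ℕ) (y : E) : s k y ≤ g y := by
    rw [← SimpleFunc.iSup_eapprox_apply hg y]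
    exact le_iSup (fun k => s k y) k
  have hlim (N : ℕ) (ω : Ω) : Filter.Tendsto
      (fun k => ∏ n ∈ Finset.range N, (1 - s k (x n ω))) Filter.atTop
      (nhds (∏ n ∈ Finset.range N, (1 - g (x n ω)))) := by
    -- Each factor is finite, so the finite product is continuous there.
    refine ENNReal.tendsto_finsetProd_of_ne_top _ (fun n _ => ?_) (fun n _ => ?_)
    · exact ENNReal.Tendsto.sub tendsto_const_nhds (SimpleFunc.tendsto_eapprox hg _)
        (Or.inl ENNReal.one_ne_top)
    · exact ne_top_of_le_ne_top ENNReal.one_ne_top tsub_le_self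
  have hanti (N : ℕ) (ω : Ω) : Antitone fun k => ∏ n ∈ Finset.range N, (1 - s k (x n ω)) :=
    fun k l hkl => Finset.prod_le_prod' fun n _ =>
      tsub_le_tsub_left (SimpleFunc.monotone_eapprox g hkl _) 1
  have hswap (ω : Ω) : ⨅ N, ∏ n ∈ Finset.range N, (1 - g (x n ω))
      = ⨅ k, ⨅ N, ∏ n ∈ Finset.range N, (1 - s k (x n ω)) := by
    rw [iInf_comm]
    exact iInf_congr fun N =>
      tendsto_nhds_unique (hlim N ω) (tendsto_atTop_iInf (hanti N ω))
  have hmono : Antitone fun k ω => ⨅ N, ∏ n ∈ Finset.range N, (1 - s k (x n ω)) :=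
    fun k l hkl ω => iInf_mono fun N => hanti N ω hkl
  simp only [hswap]
  have hbound (ω : Ω) : ⨅ N, ∏ n ∈ Finset.range N, (1 - s 0 (x n ω)) ≤ 1 :=
    (iInf_le _ 0).trans (by simp)
  rw [lintegral_iInf (f := fun k ω => ⨅ N, ∏ n ∈ Finset.range N, (1 - s k (x n ω)))
    (fun k => Measurable.iInf fun N => Finset.measurable_fun_prod _ fun n _ =>
      measurable_const.sub ((s k).measurable.comp (hx.measurable n))) hmono
    (ne_top_of_le_ne_top (by simp) (lintegral_mono hbound))]
  have hint (k : ℕ) : ∫⁻ y, s k y ∂Λ ≠ ∞ := ne_top_of_le_ne_top hfin (lintegral_mono (hle k))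
  simp only [fun k => lintegral_iInf_prod_one_sub_simpleFunc hx (s k)
    (fun y => (hle k y).trans (hg1 y)) (hint k)]
  refine tendsto_nhds_unique (tendsto_atTop_iInf fun k l hkl => ?_) ?_
  · refine ENNReal.ofReal_le_ofReal (Real.exp_le_exp.2 (neg_le_neg ?_))
    exact ENNReal.toReal_mono (hint l) (lintegral_mono (SimpleFunc.monotone_eapprox g hkl))
  · refine ENNReal.tendsto_ofReal ((Real.continuous_exp.tendsto _).comp (Filter.Tendsto.neg ?_))
    refine (ENNReal.tendsto_toReal hfin).comp ?_
    exact lintegral_tendsto_of_tendsto_of_monotone (fun k => (s k).measurable.aemeasurable)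
      (ae_of_all _ fun y k l hkl => SimpleFunc.monotone_eapprox g hkl y)
      (ae_of_all _ fun y => SimpleFunc.tendsto_eapprox hg y)

/-- The intensity measure is the mean measure of the process. -/
theorem sum_map_eq [SigmaFinite Λ] (hx : IsPoissonPointProcess x Λ P) :
    Measure.sum (fun n => P.map (x n)) = Λ := by
  have key (B : Set E) (hB : MeasurableSet B) (hfin : Λ B < ∞) :
      Measure.sum (fun n => P.map (x n)) B = Λ B := by
    rw [Measure.sum_apply _ hB]
    calc ∑' n, P.map (x n) B = ∑' n, ∫⁻ ω, B.indicator 1 (x n ω) ∂P := by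
          refine tsum_congr fun n => ?_
          rw [← lintegral_indicator_one hB, lintegral_map (measurable_one.indicator hB)
            (hx.measurable n)]
      _ = ∫⁻ ω, (pointCount x B ω : ℝ≥0∞) ∂P := by
          simp only [toENNReal_pointCount]
          exact (lintegral_tsum fun n =>
            ((measurable_one.indicator hB).comp (hx.measurable n)).aemeasurable).symm
      _ = Λ B := by
          rw [(hx.count_hasLaw B hB hfin).lintegral_comp (f := fun k => (k : ℝ≥0∞))
            (measurable_of_countable _).aemeasurable, lintegral_toENNReal_poissonMeasure,
            ENNReal.coe_toNNReal hfin.ne]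
  -- The counts are only controlled on sets of finite intensity, so localize.
  refine (Measure.ext_iff_of_iUnion_eq_univ (iUnion_spanningSets Λ)).2 fun k => ?_
  ext B hB
  rw [Measure.restrict_apply hB, Measure.restrict_apply hB]
  exact key _ (hB.inter (measurableSet_spanningSets Λ k))
    ((measure_mono Set.inter_subset_right).trans_lt (measure_spanningSets_lt_top Λ k))

/-- Campbell's formula. -/
theorem tsum_lintegral_eq [SigmaFinite Λ] (hx : IsPoissonPointProcess x Λ P) {g : E → ℝ≥0∞}
    (hg : Measurable g) : ∑' n, ∫⁻ ω, g (x n ω) ∂P = ∫⁻ y, g y ∂Λ := by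
  conv_rhs => rw [← sum_map_eq hx]
  rw [lintegral_sum_measure]
  exact tsum_congr fun n => (lintegral_map hg (hx.measurable n)).symm

end PoissonProcess

/-! ### Independently marked Poisson processes -/

section Marked

variable {Ω : Type*} [MeasurableSpace Ω] {E : Type*} [MeasurableSpace E]
  {K : Type*} [MeasurableSpace K] {x : ℕ → Ω → E} {M : ℕ → Ω → K} {Λ : Measure E} {P : Measure Ω}

/-- Given the locations, the events that the marked points avoid `G` are independent, with
conditional probabilities `1 - g (x n)`; the generating functional then gives the void probability.
The marks need not be identically distributed: it suffices that the probability `g y` of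
`(y, M n) ∈ G` does not depend on `n`. -/
theorem measure_forall_marked_notMem [IsProbabilityMeasure P] (hx : IsPoissonPointProcess x Λ P)
    (hM : ∀ n, Measurable (M n)) (hind : iIndepFun M P)
    (hxM : IndepFun (fun ω n => x n ω) (fun ω n => M n ω) P) {G : Set (E × K)}
    (hG : MeasurableSet G) {g : E → ℝ≥0∞} (hg : Measurable g)
    (hgG : ∀ n y, P {ω | (y, M n ω) ∈ G} = g y) (hfin : ∫⁻ y, g y ∂Λ ≠ ∞) :
    P {ω | ∀ n, (x n ω, M n ω) ∉ G} = ENNReal.ofReal (Real.exp (-(∫⁻ y, g y ∂Λ).toReal)) := by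
  have hX : Measurable fun ω n => x n ω := measurable_pi_lambda _ hx.measurable
  have hMm : Measurable fun ω n => M n ω := measurable_pi_lambda _ hM
  have hA : MeasurableSet {q : (ℕ → E) × (ℕ → K) | ∀ n, (q.1 n, q.2 n) ∉ G} := by
    simp only [Set.ofPred_forall]
    exact MeasurableSet.iInter fun n => (hG.preimage (by fun_prop :
      Measurable fun q : (ℕ → E) × (ℕ → K) => (q.1 n, q.2 n))).compl
  have hslice (y : ℕ → E) : P.map (fun ω n => M n ω) {k | ∀ n, (y n, k n) ∉ G}
      = ⨅ N, ∏ n ∈ Finset.range N, (1 - g (y n)) := by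
    have hGn (n : ℕ) : MeasurableSet {k | (y n, k) ∉ G} :=
      (hG.preimage measurable_prodMk_left).compl
    have hpre : {ω | ∀ n, (y n, M n ω) ∉ G}
        = ⋂ N : ℕ, ⋂ n ∈ Finset.range N, M n ⁻¹' {k | (y n, k) ∉ G} := by
      ext ω
      simp only [Set.mem_iInter, Finset.mem_range, Set.mem_preimage, Set.mem_ofPred_eq]
      exact ⟨fun h _ n _ => h n, fun h n => h (n + 1) n n.lt_succ_self⟩
    have hmeas : MeasurableSet {k : ℕ → K | ∀ n, (y n, k n) ∉ G} := by
      simp only [Set.ofPred_forall]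
      exact MeasurableSet.iInter fun n => (hGn n).preimage (measurable_pi_apply n)
    rw [Measure.map_apply hMm hmeas, Set.preimage_ofPred_eq, hpre, Antitone.measure_iInter]
    · refine iInf_congr fun N => ?_
      rw [hind.measure_inter_preimage_eq_mul (Finset.range N) fun n _ => hGn n]
      refine Finset.prod_congr rfl fun n _ => ?_
      rw [← hgG n (y n)]
      exact prob_compl_eq_one_sub ((hG.preimage measurable_prodMk_left).preimage (hM n))
    · exact fun N N' h => Set.biInter_mono (fun n hn => Finset.range_mono h hn) fun _ _ => le_rfl
    · exact fun N => (Finset.measurableSet_biInter _ fun n _ =>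
        (hGn n).preimage (hM n)).nullMeasurableSet
    · exact ⟨0, measure_ne_top _ _⟩
  have hg1 (y : E) : g y ≤ 1 := hgG 0 y ▸ prob_le_one
  rw [← lintegral_iInf_prod_one_sub hx hg hg1 hfin]
  calc P {ω | ∀ n, (x n ω, M n ω) ∉ G}
      = P.map (fun ω => ((fun n => x n ω), fun n => M n ω)) {q | ∀ n, (q.1 n, q.2 n) ∉ G} := by
        rw [Measure.map_apply (hX.prodMk hMm) hA]
        rfl
    _ = ∫⁻ y, P.map (fun ω n => M n ω) {k | ∀ n, (y n, k n) ∉ G} ∂P.map (fun ω n => x n ω) := by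
        rw [(indepFun_iff_map_prod_eq_prod_map_map hX.aemeasurable hMm.aemeasurable).1 hxM]
        have := Measure.isProbabilityMeasure_map (μ := P) hMm.aemeasurable
        rw [Measure.prod_apply hA]
        rfl
    _ = _ := by
        simp only [hslice]
        rw [lintegral_map (by fun_prop) hX]

/-- The expected number of marked points in `G`. -/
theorem tsum_measure_marked_mem [IsProbabilityMeasure P] [SigmaFinite Λ]
    (hx : IsPoissonPointProcess x Λ P) (hM : ∀ n, Measurable (M n))
    (hxM : IndepFun (fun ω n => x n ω) (fun ω n => M n ω) P) {G : Set (E × K)}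
    (hG : MeasurableSet G) {g : E → ℝ≥0∞} (hg : Measurable g)
    (hgG : ∀ n y, P {ω | (y, M n ω) ∈ G} = g y) :
    ∑' n, P {ω | (x n ω, M n ω) ∈ G} = ∫⁻ y, g y ∂Λ := by
  rw [← tsum_lintegral_eq hx hg]
  refine tsum_congr fun n => ?_
  have hxMn : IndepFun (x n) (M n) P :=
    hxM.comp (measurable_pi_apply n) (measurable_pi_apply n)
  have := Measure.isProbabilityMeasure_map (μ := P) (hM n).aemeasurable
  calc P {ω | (x n ω, M n ω) ∈ G} = P.map (fun ω => (x n ω, M n ω)) G := by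
        rw [Measure.map_apply ((hx.measurable n).prodMk (hM n)) hG]
        rfl
    _ = ∫⁻ y, P.map (M n) (Prod.mk y ⁻¹' G) ∂P.map (x n) := by
        rw [(indepFun_iff_map_prod_eq_prod_map_map (hx.measurable n).aemeasurable
          (hM n).aemeasurable).1 hxMn, Measure.prod_apply hG]
    _ = ∫⁻ y, g y ∂P.map (x n) := lintegral_congr fun y => by
        rw [← hgG n y, Measure.map_apply (hM n) (hG.preimage measurable_prodMk_left)]
        rfl
    _ = _ := lintegral_map hg (hx.measurable n)

end Marked

/-! ### The intensity of the reciprocal channel gains -/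

/-- Multiplying the gamma density by `t ^ d` gives a multiple of the gamma density of shape
`a + d`. -/
theorem lintegral_rpow_gammaMeasure {a r d : ℝ} (ha : 0 < a) (hr : 0 < r) (hd : 0 < d) :
    ∫⁻ t, ENNReal.ofReal (t ^ d) ∂gammaMeasure a r
      = ENNReal.ofReal (Real.Gamma (d + a) / (r ^ d * Real.Gamma a)) := by
  have hΓ := Real.Gamma_pos_of_pos ha
  have hΓ' := Real.Gamma_pos_of_pos (add_pos hd ha)
  have hpdf : Measurable (gammaPDF a r) := (measurable_gammaPDFReal a r).ennreal_ofReal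
  have hpdf' : Measurable (gammaPDF (d + a) r) := (measurable_gammaPDFReal _ r).ennreal_ofReal
  rw [gammaMeasure, lintegral_withDensity_eq_lintegral_mul _ hpdf (by fun_prop)]
  calc ∫⁻ t, (gammaPDF a r * fun t => ENNReal.ofReal (t ^ d)) t
      = ∫⁻ t, ENNReal.ofReal (Real.Gamma (d + a) / (r ^ d * Real.Gamma a)) *
          gammaPDF (d + a) r t := by
        refine lintegral_congr_ae ?_
        filter_upwards [Measure.ae_ne volume (0 : ℝ)] with t ht
        rcases lt_or_gt_of_ne ht with h | h
        · simp [gammaPDF_of_neg h]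
        · rw [Pi.mul_apply, gammaPDF_of_nonneg h.le, gammaPDF_of_nonneg h.le,
            ← ENNReal.ofReal_mul (by positivity), ← ENNReal.ofReal_mul (by positivity)]
          congr 1
          rw [Real.rpow_add hr, add_sub_assoc, Real.rpow_add h]
          field_simp
    _ = _ := by
        rw [lintegral_const_mul _ hpdf', lintegral_gammaPDF_eq_one (add_pos hd ha) hr, mul_one]

theorem ae_pos_gammaMeasure (a r : ℝ) : ∀ᵐ t ∂gammaMeasure a r, 0 < t := by
  have hpdf : Measurable (gammaPDF a r) := (measurable_gammaPDFReal a r).ennreal_ofReal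
  rw [gammaMeasure, ae_withDensity_iff hpdf]
  filter_upwards [Measure.ae_ne volume (0 : ℝ)] with t ht h
  by_contra hneg
  exact h (gammaPDF_of_neg (lt_of_le_of_ne (not_lt.1 hneg) ht))

theorem measurableSet_ofReal_div_lt (α ξ : ℝ) :
    MeasurableSet {q : Plane × ℝ |
      ENNReal.ofReal (‖q.1‖ ^ α) / ENNReal.ofReal q.2 < ENNReal.ofReal ξ} :=
  measurableSet_lt (by fun_prop) measurable_const

theorem measurable_gammaMeasure_ofReal_div_lt {a r : ℝ} (ha : 0 < a) (hr : 0 < r) (α ξ : ℝ) :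
    Measurable fun y : Plane => gammaMeasure a r
      {t | ENNReal.ofReal (‖y‖ ^ α) / ENNReal.ofReal t < ENNReal.ofReal ξ} := by
  have := isProbabilityMeasure_gammaMeasure ha hr
  exact measurable_measure_prodMk_left (measurableSet_ofReal_div_lt α ξ)

/-- The area of the locations from which a given power gain `t` yields a reciprocal channel gain
below `ξ`: a disc of radius `(ξ * t) ^ (1 / α)`. -/
theorem volume_ofReal_div_lt {α ξ t : ℝ} (hα : 0 < α) (hξ : 0 ≤ ξ) (ht : 0 < t) :
    volume {y : Plane | ENNReal.ofReal (‖y‖ ^ α) / ENNReal.ofReal t < ENNReal.ofReal ξ}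
      = ENNReal.ofReal (Real.pi * ξ ^ (2 / α)) * ENNReal.ofReal (t ^ (2 / α)) := by
  have hset : {y : Plane | ENNReal.ofReal (‖y‖ ^ α) / ENNReal.ofReal t < ENNReal.ofReal ξ}
      = Metric.ball 0 ((ξ * t) ^ α⁻¹) := by
    ext y
    rw [mem_ball_zero_iff, Set.mem_ofPred_eq, ← ENNReal.ofReal_div_of_pos ht,
      ENNReal.ofReal_lt_ofReal_iff_of_nonneg (by positivity), div_lt_iff₀ ht,
      Real.lt_rpow_inv_iff_of_pos (norm_nonneg _) (by positivity) hα]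
  -- Here `((ξ * t) ^ α⁻¹) ^ 2 = (ξ * t) ^ (2 / α)`.
  rw [hset, EuclideanSpace.volume_ball_fin_two, ← ENNReal.ofReal_pow (by positivity),
    ← Real.rpow_mul_natCast (by positivity), ← ENNReal.ofReal_mul (by positivity),
    ← ENNReal.ofReal_mul (by positivity), Nat.cast_ofNat, inv_mul_eq_div,
    Real.mul_rpow hξ ht.le]
  congr 1
  ring

theorem lintegral_gammaMeasure_ofReal_div_lt {α ξ a r : ℝ} (hα : 0 < α) (hξ : 0 ≤ ξ)
    (ha : 0 < a) (hr : 0 < r) :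
    ∫⁻ y : Plane, gammaMeasure a r
        {t | ENNReal.ofReal (‖y‖ ^ α) / ENNReal.ofReal t < ENNReal.ofReal ξ}
      = ENNReal.ofReal (Real.pi * ξ ^ (2 / α)) *
        ENNReal.ofReal (Real.Gamma (2 / α + a) / (r ^ (2 / α) * Real.Gamma a)) := by
  have := isProbabilityMeasure_gammaMeasure ha hr
  have hS := measurableSet_ofReal_div_lt α ξ
  rw [← lintegral_rpow_gammaMeasure ha hr (by positivity : 0 < 2 / α),
    ← lintegral_const_mul _ (by fun_prop)]
  refine Eq.trans (Measure.prod_apply hS).symm ?_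
  rw [Measure.prod_apply_symm hS]
  refine lintegral_congr_ae ?_
  filter_upwards [ae_pos_gammaMeasure a r] with t ht
  exact volume_ofReal_div_lt hα hξ ht

/-! ### The smallest reciprocal gain in a caching network -/

/-- The marked points `(location, (fading coefficient, cache))` of the helpers that cache content
`i` with reciprocal channel gain below `ξ`. -/
def goodHelpers (F : ℕ) (α ξ : ℝ) (i : Fin F) : Set (Plane × (ℂ × Set (Fin F))) :=
  {q | i ∈ q.2.2 ∧ reciprocalGain α q.1 q.2.1 < ENNReal.ofReal ξ}

/-- The probability that a helper at `y` caches a given content of caching probability `p` with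
reciprocal channel gain below `ξ`. -/
noncomputable def goodProb (α m p ξ : ℝ) (y : Plane) : ℝ≥0∞ :=
  ENNReal.ofReal p * gammaMeasure m m
    {t | ENNReal.ofReal (‖y‖ ^ α) / ENNReal.ofReal t < ENNReal.ofReal ξ}

theorem minReciprocalGain_lt_iff {Ω : Type*} {F : ℕ} {α ξ : ℝ} {x : ℕ → Ω → Plane} {h : ℕ → Ω → ℂ}
    {C : ℕ → Ω → Set (Fin F)} {i : Fin F} {ω : Ω} :
    minReciprocalGain α x h C i ω < ENNReal.ofReal ξ ↔
      ∃ n, (x n ω, (h n ω, C n ω)) ∈ goodHelpers F α ξ i := by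
  simp only [minReciprocalGain, sInf_lt_iff, reciprocalGains, goodHelpers, Set.mem_ofPred_eq]
  constructor
  · rintro ⟨_, ⟨n, hn, rfl⟩, hlt⟩
    exact ⟨n, hn, hlt⟩
  · rintro ⟨n, hn, hlt⟩
    exact ⟨_, ⟨n, hn, rfl⟩, hlt⟩

/-- The infimum is attained as soon as it lies below a level under which there are only finitely
many gains. -/
theorem isLeast_minReciprocalGain {Ω : Type*} {F : ℕ} {α ξ : ℝ} {x : ℕ → Ω → Plane} {h : ℕ → Ω → ℂ}
    {C : ℕ → Ω → Set (Fin F)} {i : Fin F} {ω : Ω}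
    (hfin : {n | (x n ω, (h n ω, C n ω)) ∈ goodHelpers F α ξ i}.Finite)
    (hlt : minReciprocalGain α x h C i ω < ENNReal.ofReal ξ) :
    IsLeast (reciprocalGains α x h C i ω) (minReciprocalGain α x h C i ω) := by
  obtain ⟨n, hn, hmin⟩ := hfin.exists_minimalFor (fun n => reciprocalGain α (x n ω) (h n ω)) _
    (minReciprocalGain_lt_iff.1 hlt)
  have hleast : IsLeast (reciprocalGains α x h C i ω) (reciprocalGain α (x n ω) (h n ω)) := by
    refine ⟨⟨n, hn.1, rfl⟩, ?_⟩
    rintro _ ⟨k, hk, rfl⟩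
    rcases lt_or_ge (reciprocalGain α (x k ω) (h k ω)) (ENNReal.ofReal ξ) with h1 | h1
    · exact (le_total _ _).elim id fun hle => hmin ⟨hk, h1⟩ hle
    · exact hn.2.le.trans h1
  rw [minReciprocalGain, hleast.csInf_eq]
  exact hleast

section Network

variable {Ω : Type*} [MeasurableSpace Ω] {F : ℕ}

theorem measurableSet_goodHelpers (α ξ : ℝ) (i : Fin F) :
    MeasurableSet (goodHelpers F α ξ i) := by
  have hgain : Measurable fun q : Plane × (ℂ × Set (Fin F)) => reciprocalGain α q.1 q.2.1 := by
    unfold reciprocalGain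
    fun_prop
  exact (measurableSet_setOfPred.2 ((measurable_set_mem i).comp
    (measurable_snd.comp measurable_snd))).inter (measurableSet_lt hgain measurable_const)

theorem measurable_goodProb {α m p ξ : ℝ} (hm : 0 < m) : Measurable (goodProb α m p ξ) :=
  (measurable_gammaMeasure_ofReal_div_lt hm hm α ξ).const_mul _

/-- The probability does not depend on the helper `n`, although the joint law of its cached
contents may. -/
theorem measure_mem_goodHelpers {lam α m ξ : ℝ} {p : Fin F → ℝ} {x : ℕ → Ω → Plane}
    {h : ℕ → Ω → ℂ} {C : ℕ → Ω → Set (Fin F)} {P : Measure Ω} [IsProbabilityMeasure P]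
    (hnet : IsCachingNetwork lam m p x h C P) (i : Fin F) (n : ℕ) (y : Plane) :
    P {ω | (y, (h n ω, C n ω)) ∈ goodHelpers F α ξ i} = goodProb α m (p i) ξ y := by
  have hcache : MeasurableSet {c : Set (Fin F) | i ∈ c} :=
    measurableSet_setOfPred.2 (measurable_set_mem i)
  have hgain : MeasurableSet {z : ℂ | reciprocalGain α y z < ENNReal.ofReal ξ} :=
    measurableSet_lt (by unfold reciprocalGain; fun_prop) measurable_const
  have hprob : P (C n ⁻¹' {c | i ∈ c}) = ENNReal.ofReal (p i) := by
    rw [← hnet.cache_prob n i, ofReal_measureReal]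
    rfl
  have hlaw : P (h n ⁻¹' {z | reciprocalGain α y z < ENNReal.ofReal ξ}) = gammaMeasure m m
      {t | ENNReal.ofReal (‖y‖ ^ α) / ENNReal.ofReal t < ENNReal.ofReal ξ} :=
    (hnet.fading n).measure_eq
      (p := fun t => ENNReal.ofReal (‖y‖ ^ α) / ENNReal.ofReal t < ENNReal.ofReal ξ)
      (measurableSet_lt (by fun_prop) measurable_const)
  rw [goodProb, ← hprob, ← hlaw, mul_comm,
    ← (hnet.indep_fading_cache n).measure_inter_preimage_eq_mul _ _ hgain hcache, Set.inter_comm]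
  rfl

/-- The mean number of helpers that cache a given content of caching probability `p` with
reciprocal channel gain below `ξ`. -/
theorem lintegral_goodProb {lam α m p ξ : ℝ} (hlam : 0 < lam) (hα : 0 < α) (hm : 0 < m)
    (hp : 0 ≤ p) (hξ : 0 ≤ ξ) :
    ∫⁻ y, goodProb α m p ξ y ∂(ENNReal.ofReal lam • (volume : Measure Plane))
      = ENNReal.ofReal (Real.pi * lam *
        (Real.Gamma (2 / α + m) / (m ^ (2 / α) * Real.Gamma m)) * p * ξ ^ (2 / α)) := by
  have hΓ := Real.Gamma_pos_of_pos hm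
  have hΓ' := Real.Gamma_pos_of_pos (add_pos (by positivity : 0 < 2 / α) hm)
  simp only [goodProb]
  rw [lintegral_smul_measure, lintegral_const_mul _
      (measurable_gammaMeasure_ofReal_div_lt hm hm α ξ),
    lintegral_gammaMeasure_ofReal_div_lt hα hξ hm hm, smul_eq_mul,
    ← ENNReal.ofReal_mul (by positivity), ← ENNReal.ofReal_mul hp,
    ← ENNReal.ofReal_mul hlam.le]
  congr 1
  ring

/-- The strict distribution function is a void probability of the marked process. -/
theorem measureReal_minReciprocalGain_lt {lam α m ξ : ℝ} {p : Fin F → ℝ} {x : ℕ → Ω → Plane}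
    {h : ℕ → Ω → ℂ} {C : ℕ → Ω → Set (Fin F)} {P : Measure Ω} [IsProbabilityMeasure P]
    (hlam : 0 < lam) (hα : 0 < α) (hm : 0 < m) (hnet : IsCachingNetwork lam m p x h C P)
    (i : Fin F) (hp : 0 ≤ p i) (hξ : 0 ≤ ξ) :
    P.real {ω | minReciprocalGain α x h C i ω < ENNReal.ofReal ξ}
      = 1 - Real.exp (-(Real.pi * lam *
        (Real.Gamma (2 / α + m) / (m ^ (2 / α) * Real.Gamma m)) * p i * ξ ^ (2 / α))) := by
  have hΓ := Real.Gamma_pos_of_pos hm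
  have hΓ' := Real.Gamma_pos_of_pos (add_pos (by positivity : 0 < 2 / α) hm)
  have hM (n : ℕ) : Measurable fun ω => (h n ω, C n ω) :=
    (hnet.measurable_fading n).prodMk (hnet.measurable_cache n)
  have hint := lintegral_goodProb (ξ := ξ) hlam hα hm hp hξ
  have hvoid := measure_forall_marked_notMem hnet.helpers_poisson hM hnet.indep_marks
    hnet.indep_locations_marks (measurableSet_goodHelpers α ξ i) (measurable_goodProb hm)
    (fun n y => measure_mem_goodHelpers hnet i n y) (hint ▸ ENNReal.ofReal_ne_top)
  rw [hint, ENNReal.toReal_ofReal (by positivity)] at hvoid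
  have hcompl : {ω | minReciprocalGain α x h C i ω < ENNReal.ofReal ξ}
      = {ω | ∀ n, (x n ω, (h n ω, C n ω)) ∉ goodHelpers F α ξ i}ᶜ := by
    ext ω
    simp [minReciprocalGain_lt_iff]
  have hmeas : MeasurableSet {ω | ∀ n, (x n ω, (h n ω, C n ω)) ∉ goodHelpers F α ξ i} := by
    simp only [Set.ofPred_forall]
    exact MeasurableSet.iInter fun n => ((measurableSet_goodHelpers α ξ i).preimage
      ((hnet.helpers_poisson.measurable n).prodMk (hM n))).compl
  rw [hcompl, probReal_compl_eq_one_sub hmeas, measureReal_def, hvoid,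
    ENNReal.toReal_ofReal (Real.exp_pos _).le]

/-- Almost surely only finitely many helpers caching content `i` have a reciprocal channel gain
below `ξ`, since their mean number is finite. -/
theorem ae_finite_goodHelpers {lam α m ξ : ℝ} {p : Fin F → ℝ} {x : ℕ → Ω → Plane}
    {h : ℕ → Ω → ℂ} {C : ℕ → Ω → Set (Fin F)} {P : Measure Ω} [IsProbabilityMeasure P]
    (hlam : 0 < lam) (hα : 0 < α) (hm : 0 < m) (hnet : IsCachingNetwork lam m p x h C P)
    (i : Fin F) (hp : 0 ≤ p i) (hξ : 0 ≤ ξ) :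
    ∀ᵐ ω ∂P, {n | (x n ω, (h n ω, C n ω)) ∈ goodHelpers F α ξ i}.Finite := by
  have hM (n : ℕ) : Measurable fun ω => (h n ω, C n ω) :=
    (hnet.measurable_fading n).prodMk (hnet.measurable_cache n)
  have : SigmaFinite (ENNReal.ofReal lam • (volume : Measure Plane)) :=
    inferInstanceAs (SigmaFinite (lam.toNNReal • (volume : Measure Plane)))
  refine ae_finite_setOfPred_mem
    (s := fun n => {ω | (x n ω, (h n ω, C n ω)) ∈ goodHelpers F α ξ i}) ?_
  rw [tsum_measure_marked_mem hnet.helpers_poisson hM hnet.indep_locations_marks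
    (measurableSet_goodHelpers α ξ i) (measurable_goodProb hm)
    (fun n y => measure_mem_goodHelpers hnet i n y), lintegral_goodProb hlam hα hm hp hξ]
  exact ENNReal.ofReal_ne_top

end Network

end WirelessCaching

theorem lemma1 {Ω : Type*} [MeasurableSpace Ω] (P : Measure Ω) [IsProbabilityMeasure P]
    {F : ℕ} (lam α m δ κ : ℝ) (p : Fin F → ℝ)
    (hlam : 0 < lam) (hα : 2 < α) (hm : 1 / 2 ≤ m) (hp : ∀ j, 0 ≤ p j ∧ p j ≤ 1)
    (hδ : δ = 2 / α)
    (hκ : κ = Real.pi * lam * (Real.Gamma (δ + m) / (m ^ δ * Real.Gamma m)))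
    (x : ℕ → Ω → WirelessCaching.Plane) (h : ℕ → Ω → ℂ) (C : ℕ → Ω → Set (Fin F))
    (hnet : WirelessCaching.IsCachingNetwork lam m p x h C P) (i : Fin F) :
    (0 < p i → ∀ᵐ ω ∂P, IsLeast (WirelessCaching.reciprocalGains α x h C i ω)
      (WirelessCaching.minReciprocalGain α x h C i ω)) ∧
    ∀ ξ : ℝ, 0 ≤ ξ →
      P.real {ω | WirelessCaching.minReciprocalGain α x h C i ω ≤ ENNReal.ofReal ξ}
          = 1 - Real.exp (-(κ * p i * ξ ^ δ)) ∧
      P.real {ω | WirelessCaching.minReciprocalGain α x h C i ω < ENNReal.ofReal ξ}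
          = 1 - Real.exp (-(κ * p i * ξ ^ δ)) := by
  have hα0 : 0 < α := by linarith
  have hm0 : 0 < m := by linarith
  have hδ0 : 0 < δ := hδ ▸ by positivity
  have hκ0 : 0 < κ := by
    have hΓ := Real.Gamma_pos_of_pos hm0
    have hΓ' := Real.Gamma_pos_of_pos (add_pos hδ0 hm0)
    rw [hκ]
    positivity
  have hlt (ξ : ℝ) (hξ : 0 ≤ ξ) :
      P.real {ω | WirelessCaching.minReciprocalGain α x h C i ω < ENNReal.ofReal ξ}
        = 1 - Real.exp (-(κ * p i * ξ ^ δ)) := by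
    rw [hκ, hδ]
    exact WirelessCaching.measureReal_minReciprocalGain_lt hlam hα0 hm0 hnet i (hp i).1 hξ
  refine ⟨fun hpi => ?_, fun ξ hξ => ⟨le_antisymm ?_ ?_, hlt ξ hξ⟩⟩
  · have hfin : ∀ᵐ ω ∂P, ∀ k : ℕ,
        {n | (x n ω, (h n ω, C n ω)) ∈ WirelessCaching.goodHelpers F α k i}.Finite :=
      ae_all_iff.2 fun k =>
        WirelessCaching.ae_finite_goodHelpers hlam hα0 hm0 hnet i (hp i).1 k.cast_nonneg
    -- The distribution function tends to `1`, so that the infimum is almost surely finite.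
    have hlim : Filter.Tendsto (fun k : ℕ => 1 - Real.exp (-(κ * p i * (k : ℝ) ^ δ)))
        Filter.atTop (nhds 1) := by
      have h1 : Filter.Tendsto (fun k : ℕ => κ * p i * (k : ℝ) ^ δ) Filter.atTop Filter.atTop :=
        ((tendsto_rpow_atTop hδ0).comp tendsto_natCast_atTop_atTop).const_mul_atTop
          (mul_pos hκ0 hpi)
      simpa using (Real.tendsto_exp_neg_atTop_nhds_zero.comp h1).const_sub 1
    have hone : P.real {ω | ∃ k : ℕ,
        WirelessCaching.minReciprocalGain α x h C i ω < ENNReal.ofReal k} = 1 := by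
      refine le_antisymm measureReal_le_one (le_of_tendsto' hlim fun k => ?_)
      rw [← hlt k k.cast_nonneg]
      exact measureReal_mono fun ω hω => ⟨k, hω⟩
    have hex : ∀ᵐ ω ∂P, ∃ k : ℕ,
        WirelessCaching.minReciprocalGain α x h C i ω < ENNReal.ofReal k := by
      have hmeas : MeasurableSet {ω | ∃ k : ℕ,
          WirelessCaching.minReciprocalGain α x h C i ω < ENNReal.ofReal k} := by
        simp only [WirelessCaching.minReciprocalGain_lt_iff, Set.ofPred_exists]
        exact MeasurableSet.iUnion fun k => MeasurableSet.iUnion fun n =>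
          (WirelessCaching.measurableSet_goodHelpers α k i).preimage
            ((hnet.helpers_poisson.measurable n).prodMk
              ((hnet.measurable_fading n).prodMk (hnet.measurable_cache n)))
      rw [measureReal_def, ENNReal.toReal_eq_one_iff] at hone
      exact (mem_ae_iff_prob_eq_one hmeas).2 hone
    filter_upwards [hfin, hex] with ω hω ⟨k, hk⟩
    exact WirelessCaching.isLeast_minReciprocalGain (hω k) hk
  · -- The formula for the strict distribution function is right-continuous.
    have hcont : Filter.Tendsto (fun η : ℝ => 1 - Real.exp (-(κ * p i * η ^ δ)))
        (nhdsWithin ξ (Set.Ioi ξ)) (nhds (1 - Real.exp (-(κ * p i * ξ ^ δ)))) :=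
      (Continuous.tendsto (continuous_const.sub (Real.continuous_exp.comp
        (continuous_const.mul (Real.continuous_rpow_const hδ0.le)).neg)) ξ).mono_left
        nhdsWithin_le_nhds
    refine ge_of_tendsto hcont ?_
    filter_upwards [self_mem_nhdsWithin] with η hη
    have hη' : ξ < η := hη
    rw [← hlt η (hξ.trans hη'.le)]
    exact measureReal_mono fun ω hω => lt_of_le_of_lt hω
      ((ENNReal.ofReal_lt_ofReal_iff (hξ.trans_lt hη')).2 hη')
  · rw [← hlt ξ hξ]
    exact measureReal_mono fun ω hω => le_of_lt (Set.mem_ofPred_eq ▸ hω)
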